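/- Let $B\subset\mathbb R^d$ be a bounded Borel set of positive Lebesgue measure, and let $(\mathbf N,\mathcal N)$ be the space of integer-valued finite measures on $B$, where $\mathcal N$ is the smallest $\sigma$-algebra making all maps $x\mapsto x(A)$, $A\subset B$ Borel, measurable; an element of $\mathbf N$ is also identified with the set of its points. Let $\eta$ be a Poisson point process on $B$ with finite atomless intensity measure $\lambda$ and distribution $P_\eta$ on $\mathcal N$. Let $\mu$ be a finite point process on $B$ with density $p$ with respect to $P_\eta$, i.e. $p:\mathbf N\to[0,\infty)$ is measurable, $\int p\,dP_\eta=1$ and $\mu$ has distribution $dP_\mu=p\,dP_\eta$. Assume that $p$ is hereditary: $p(x)>0$ implies $p(\tilde x)>0$ for all $\tilde x\subset x$. For $n\ge1$ let $$\lambda^*_n(u_1,\dots,u_n,x)=\frac{p(x\cup\{u_1,\dots,u_n\})}{p(x)}\quad(\text{and } 0 \text{ if } p(x)=0),$$ for distinct $u_1,\dots,u_n\in B\setminus x$, be the $n$-th order Papangelou conditional intensity of $\mu$, and let $\lambda^*_0\equiv1$. Let $f:B^k\to\mathbb R$ be symmetric with $f\in L_1(\lambda^k)$, and let $F(x)=\sum_{(x_1,\dots,x_k)\in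 x^k_{\neq}}f(x_1,\dots,x_k)$ be the $U$-statistic of order $k$ driven by $f$, where $x^k_{\ne}$ is the set of $k$-tuples of pairwise different points of $x$. If $F\in L_2(P_\eta)$ and $p\in L_2(P_\eta)$, then $$\mathbb E F(\mu)=\int_{B^k}f(x_1,\dots,x_k)\,\mathbb E\big[\lambda^*_k(x_1,\dots,x_k,\mu)\big]\,\lambda^k(d(x_1,\dots,x_k)),$$ where the expectation on the left exists and is finite, the expectation on the right is finite for $\lambda^k$-almost every $(x_1,\dots,x_k)$, and the integral over $B^k$ converges absolutely. -/

import Mathlib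

open MeasureTheory ProbabilityTheory
open scoped ENNReal NNReal

/-- The space of integer-valued finite measures on `E`. As a subtype of `Measure E` it carries the
smallest σ-algebra for which all evaluations `x ↦ x A`, with `A` measurable, are measurable. -/
abbrev Config (E : Type*) [MeasurableSpace E] : Type _ :=
  {x : Measure E // ∀ A : Set E, MeasurableSet A → ∃ n : ℕ, x A = n}

namespace Config

variable {E : Type*} [MeasurableSpace E]

/-- The points of the configuration `x`, i.e. its atoms. -/
def points (x : Config E) : Set E := {u | x.1 {u} ≠ 0}

/-- The configuration `x` has no multiple points. -/
def IsSimple (x : Config E) : Prop := ∀ u : E, x.1 {u} ≤ 1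

/-- A configuration has finitely many points, so the sums over tuples of points below are finite. -/
theorem points_finite [MeasurableSingletonClass E] (x : Config E) : x.points.Finite := by
  have hfin : x.1 Set.univ ≠ ∞ := by
    obtain ⟨n, hn⟩ := x.2 Set.univ MeasurableSet.univ
    rw [hn]
    exact ENNReal.natCast_ne_top n
  refine (Measure.finite_const_le_meas_of_disjoint_iUnion x.1 (ε := 1) one_pos
    (As := fun u : E => {u}) (fun u => measurableSet_singleton u)
    (fun u v huv => by simpa using huv)
    (ne_top_of_le_ne_top hfin (measure_mono (Set.subset_univ _)))).subset ?_
  intro u hu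
  obtain ⟨n, hn⟩ := x.2 {u} (measurableSet_singleton u)
  simp only [points, Set.mem_ofPred_eq, hn] at hu ⊢
  exact_mod_cast Nat.one_le_iff_ne_zero.mpr (by exact_mod_cast hu)

/-- The set `x^k_≠` of `k`-tuples of pairwise different points of `x`. -/
def tuples (k : ℕ) (x : Config E) : Set (Fin k → E) :=
  {v | Function.Injective v ∧ ∀ i, v i ∈ x.points}

/-- There are only finitely many such tuples. -/
theorem tuples_finite [MeasurableSingletonClass E] (k : ℕ) (x : Config E) :
    (x.tuples k).Finite :=
  (Set.Finite.pi' (fun _ : Fin k => x.points_finite)).subset fun _ hv => hv.2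

/-- The configuration `x ∪ {u_1, …, u_n}`, i.e. the measure `x + δ_{u_1} + … + δ_{u_n}`. -/
noncomputable def addPoints {n : ℕ} (x : Config E) (u : Fin n → E) : Config E :=
  ⟨x.1 + ∑ i, Measure.dirac (u i), by
    classical
    intro A hA
    obtain ⟨m, hm⟩ := x.2 A hA
    refine ⟨m + ∑ i, if u i ∈ A then 1 else 0, ?_⟩
    simp [hm, Measure.dirac_apply' _ hA, Set.indicator_apply]⟩

end Config

/-- `P` is the distribution of a Poisson point process on `E` with finite intensity measure `Λ`:
the number of points in a measurable set `A` is Poisson distributed with mean `Λ A`, and the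
numbers of points in pairwise disjoint measurable sets are independent. -/
structure IsPoissonLaw {E : Type*} [MeasurableSpace E] (Λ : Measure E)
    (P : Measure (Config E)) : Prop where
  map_count : ∀ A : Set E, MeasurableSet A →
    P.map (fun x => x.1 A) =
      (poissonMeasure (Λ A).toNNReal).map (fun n : ℕ => (n : ℝ≥0∞))
  indep : ∀ (n : ℕ) (A : Fin n → Set E), (∀ i, MeasurableSet (A i)) →
    Pairwise (Function.onFun Disjoint A) → iIndepFun (fun i x => x.1 (A i)) P

/-- The functional `x ↦ ∑_{(x_1, …, x_k) ∈ x^k_≠} f (x_1, …, x_k)`. -/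
noncomputable def uStatistic {E : Type*} [MeasurableSpace E] {k : ℕ} (f : (Fin k → E) → ℝ)
    (x : Config E) : ℝ :=
  ∑ᶠ v ∈ x.tuples k, f v

/-- The density `p` is hereditary: `p x > 0` implies `p y > 0` for all `y ⊂ x`, where `x` is a
configuration without multiple points. -/
def IsHereditary {E : Type*} [MeasurableSpace E] (p : Config E → ℝ≥0) : Prop :=
  ∀ x y : Config E, x.IsSimple → y ≤ x → 0 < p x → 0 < p y

/-- The conditional intensity of order `n` of the point process with density `p`:
`λ*_n (u_1, …, u_n, x) = p (x ∪ {u_1, …, u_n}) / p x`, which is `0` if `p x = 0`, and `λ*_0 = 1`.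
Only pairwise distinct `u_i` which are not points of `x` matter. -/
noncomputable def papangelou {E : Type*} [MeasurableSpace E] (p : Config E → ℝ≥0) (n : ℕ)
    (u : Fin n → E) (x : Config E) : ℝ :=
  if n = 0 then 1 else (p (x.addPoints u) : ℝ) / (p x : ℝ)

/-! The Poisson law is an explicit mixture: its `n`-point component is the image of `Λ^n` under
`ofTuple`, with weight `exp(-Λ(E))/n!` (`IsPoissonLaw.eq_poissonMixture`, by comparing
characteristic functionals). On `n` points without repetition, `F` is a sum over embeddings `Fin k ↪
Fin n`. By exchangeability all of them contribute equally to `E[p F]`, and there are `n!/(n-k)!` of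
them, so the weight of `n` points becomes that of `n-k`. This is the Mecke formula `E[p(η) F(η)] = ∫
f(u) E[p(η ∪ u)] Λ^k(du)` (`integral_mul_uStatistic`). Heredity gives `p(x) λ*_k(u, x) = p(x ∪ u)`
almost everywhere, and the claim follows.

Fubini needs `f(u) p(x ∪ u)` to be integrable (`integrable_mul_meckeMeasure`). On exactly `k` points
`F = k! f`, so `F ∈ L₂` forces `f ∈ L₂(Λ^k)`. A weighted Young inequality on each component then
bounds `|f p|` by a summable multiple of `∫ f²` plus a part of `E[p²]`. -/

namespace Config

/-! ### Configurations and their characteristic functionals -/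

variable {E : Type*} [MeasurableSpace E]

instance isFiniteMeasure (x : Config E) : IsFiniteMeasure x.1 := by
  obtain ⟨n, hn⟩ := x.2 Set.univ MeasurableSet.univ
  exact ⟨by rw [hn]; exact ENNReal.natCast_lt_top n⟩

/-- The configuration `δ_{v_1} + … + δ_{v_n}`. -/
noncomputable def ofTuple {n : ℕ} (v : Fin n → E) : Config E :=
  addPoints ⟨0, fun _ _ => ⟨0, by simp⟩⟩ v

theorem ofTuple_val {n : ℕ} (v : Fin n → E) :
    (ofTuple v).1 = ∑ i, Measure.dirac (v i) := by
  simp [ofTuple, addPoints]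

theorem measurable_addPoints (n : ℕ) :
    Measurable fun z : (Fin n → E) × Config E => z.2.addPoints z.1 := by
  refine Measurable.subtype_mk (Measure.measurable_of_measurable_coe _ fun A hA => ?_)
  simp only [Measure.coe_add, Measure.coe_finsetSum, Pi.add_apply, Finset.sum_apply]
  refine ((Measure.measurable_coe hA).comp (measurable_subtype_coe.comp measurable_snd)).add
    (Finset.measurable_sum _ fun i _ => ?_)
  exact (Measure.measurable_coe hA).comp
    (Measure.measurable_dirac.comp ((measurable_pi_apply i).comp measurable_fst))

theorem measurable_ofTuple (n : ℕ) : Measurable (ofTuple : (Fin n → E) → Config E) :=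
  (measurable_addPoints n).comp (measurable_id.prodMk measurable_const)

theorem measurable_count {A : Set E} (hA : MeasurableSet A) :
    Measurable fun x : Config E => x.1 A :=
  (Measure.measurable_coe hA).comp measurable_subtype_coe

/-- The number of points in each measurable set, as a family of reals. -/
noncomputable def counts (x : Config E) (A : {A : Set E // MeasurableSet A}) : ℝ := x.1.real A

theorem measurable_counts : Measurable (counts : Config E → _) :=
  measurable_pi_lambda _ fun A => (measurable_count A.2).ennreal_toReal

/-- Counts are finite, so passing to real values loses nothing; laws of configurations thereby
become laws on a product of real lines. -/
theorem measurableSpace_eq_comap_counts :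
    (inferInstance : MeasurableSpace (Config E)) = MeasurableSpace.comap counts inferInstance := by
  refine le_antisymm ?_ measurable_counts.comap_le
  have key : Measurable[MeasurableSpace.comap counts inferInstance]
      (Subtype.val : Config E → Measure E) := by
    let _ : MeasurableSpace (Config E) := MeasurableSpace.comap counts inferInstance
    refine Measure.measurable_of_measurable_coe _ fun A hA => ?_
    have : (fun x : Config E => x.1 A) = fun x => ENNReal.ofReal (counts x ⟨A, hA⟩) := by
      ext x
      simp [counts]
    rw [this]
    exact ENNReal.measurable_ofReal.comp
      (Measurable.comp (g := fun c : {A : Set E // MeasurableSet A} → ℝ => c ⟨A, hA⟩)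
        (measurable_pi_apply _) (comap_measurable counts))
  exact key.comap_le

/-- A finite measure on configurations is determined by the characteristic functions of the
linear statistics `∫ g dx`, with `g` simple. -/
theorem ext_of_integral_exp {P Q : Measure (Config E)} [IsFiniteMeasure P] [IsFiniteMeasure Q]
    (h : ∀ g : SimpleFunc E ℝ, ∫ x, Complex.exp ((∫ b, g b ∂x.1 : ℝ) * Complex.I) ∂P =
      ∫ x, Complex.exp ((∫ b, g b ∂x.1 : ℝ) * Complex.I) ∂Q) : P = Q := by
  classical
  -- A finite measure on a product is determined by its finite-dimensional marginals, and these by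
  -- their characteristic functions.
  have hmap : P.map counts = Q.map counts := by
    refine IsProjectiveLimit.unique (P := fun J => (P.map counts).map J.restrict)
      (fun J => rfl) (fun J => ?_)
    refine Measure.ext_of_charFunDual (funext fun L => ?_)
    -- With `g = ∑ j, L(e_j) 1_{A_j}`, the functional `L` of the counts is `∫ g dx`.
    let g : SimpleFunc E ℝ :=
      ∑ j : J, SimpleFunc.restrict (SimpleFunc.const E (L (Pi.single j 1))) j.1.1
    have hL : ∀ x : Config E, L (J.restrict (counts x)) = ∫ b, g b ∂x.1 := by
      intro x
      have h1 : J.restrict (counts x) = ∑ j : J, counts x j.1 • (Pi.single j 1 : J → ℝ) := by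
        ext i
        simp [Finset.sum_apply, Pi.single_apply]
      have h2 : ∀ b, g b =
          ∑ j : J, Set.indicator j.1.1 (fun _ => L (Pi.single j 1)) b := by
        intro b
        have h3 : ∀ s : Finset J, (∑ j ∈ s, SimpleFunc.restrict
            (SimpleFunc.const E (L (Pi.single j 1))) j.1.1) b =
            ∑ j ∈ s, SimpleFunc.restrict (SimpleFunc.const E (L (Pi.single j 1))) j.1.1 b := by
          intro s
          induction s using Finset.induction_on with
          | empty => simp
          | insert a s ha ih => rw [Finset.sum_insert ha, Finset.sum_insert ha,
              SimpleFunc.add_apply, ih]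
        refine (h3 _).trans ?_
        refine Finset.sum_congr rfl fun j _ => ?_
        rw [SimpleFunc.restrict_apply _ j.1.2]
        rfl
      rw [h1, map_sum]
      simp_rw [h2]
      rw [integral_finsetSum _ fun j _ => (integrable_const _).indicator j.1.2]
      refine Finset.sum_congr rfl fun j _ => ?_
      rw [integral_indicator_const _ j.1.2]
      simp [counts]
    have hm : ∀ M : Measure (Config E), charFunDual ((M.map counts).map J.restrict) L =
        ∫ x, Complex.exp ((∫ b, g b ∂x.1 : ℝ) * Complex.I) ∂M := by
      intro M
      rw [charFunDual_apply, integral_map (by fun_prop) (by fun_prop),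
        integral_map measurable_counts.aemeasurable]
      · simp_rw [hL]
      · exact Measurable.aestronglyMeasurable (by fun_prop)
    rw [hm, hm, h]
  ext s hs
  replace hs : MeasurableSet[MeasurableSpace.comap counts inferInstance] s :=
    measurableSpace_eq_comap_counts (E := E) ▸ hs
  obtain ⟨t, ht, rfl⟩ := hs
  rw [← Measure.map_apply measurable_counts ht, hmap, Measure.map_apply measurable_counts ht]

end Config

/-! ### The Poisson law as a mixture -/

open Config in
theorem IsPoissonLaw.isProbabilityMeasure {E : Type*} [MeasurableSpace E] {Λ : Measure E}
    {P : Measure (Config E)} (h : IsPoissonLaw Λ P) : IsProbabilityMeasure P := by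
  have h1 := h.map_count Set.univ MeasurableSet.univ
  have : IsProbabilityMeasure (P.map fun x => x.1 Set.univ) := by
    rw [h1]; infer_instance
  exact (Measure.isProbabilityMeasure_map_iff (measurable_count .univ).aemeasurable).1 this

open Config in
/-- The characteristic function of a linear statistic of a Poisson process. -/
theorem IsPoissonLaw.integral_exp {E : Type*} [MeasurableSpace E] {Λ : Measure E}
    [IsFiniteMeasure Λ] {P : Measure (Config E)} (h : IsPoissonLaw Λ P) (g : SimpleFunc E ℝ) :
    ∫ x, Complex.exp ((∫ b, g b ∂x.1 : ℝ) * Complex.I) ∂P =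
      Complex.exp (∫ b, (Complex.exp (g b * Complex.I) - 1) ∂Λ) := by
  have := h.isProbabilityMeasure
  set n := Fintype.card g.range with hn
  let e : Fin n ≃ g.range := (Fintype.equivFin g.range).symm
  -- The level sets of `g` are disjoint, so their counts are independent Poisson variables and the
  -- expectation factorises.
  let D : Fin n → Set E := fun i => g ⁻¹' {(e i : ℝ)}
  have hD : ∀ i, MeasurableSet (D i) := fun i => g.measurableSet_fiber _
  have hdisj : Pairwise (Function.onFun Disjoint D) := by
    intro i j hij
    refine Disjoint.preimage _ (Set.disjoint_singleton.2 fun hh => hij ?_)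
    exact e.injective (Subtype.ext hh)
  have hint : ∀ x : Config E, ∫ b, g b ∂x.1 = ∑ i, (x.1 (D i)).toReal * (e i : ℝ) := by
    intro x
    rw [← SimpleFunc.integral_eq_integral _ (SimpleFunc.integrable_of_isFiniteMeasure g),
      SimpleFunc.integral_eq, ← Finset.sum_coe_sort, ← e.sum_comp]
    rfl
  have hintΛ : ∫ b, (Complex.exp (g b * Complex.I) - 1) ∂Λ =
      ∑ i, ((Λ (D i)).toReal : ℂ) * (Complex.exp ((e i : ℝ) * Complex.I) - 1) := by
    let φ : ℝ → ℂ := fun r => Complex.exp (r * Complex.I) - 1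
    have : ∀ b, φ (g b) = ∑ i, (D i).indicator (fun _ => φ (e i)) b := by
      intro b
      rw [Finset.sum_eq_single (e.symm ⟨g b, g.mem_range_self b⟩)]
      · simp [D]
      · intro j _ hj
        refine Set.indicator_of_notMem (fun hb => hj ?_) _
        rw [Equiv.eq_symm_apply]
        exact Subtype.ext hb.symm
      · simp
    change ∫ b, φ (g b) ∂Λ = _
    simp_rw [this]
    rw [integral_finsetSum _ fun j _ => (integrable_const _).indicator (hD j)]
    refine Finset.sum_congr rfl fun j _ => ?_
    rw [integral_indicator_const _ (hD j)]
    simp [φ, measureReal_def]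
  have hind : iIndepFun (fun i x => ((x : Config E).1 (D i)).toReal) P :=
    (h.indep n D hD hdisj).comp (fun _ => ENNReal.toReal) fun _ => ENNReal.measurable_toReal
  have hexp : ∀ x : Config E, Complex.exp ((∫ b, g b ∂x.1 : ℝ) * Complex.I) =
      ∏ i, Complex.exp (((x.1 (D i)).toReal * (e i : ℝ) : ℝ) * Complex.I) := by
    intro x
    rw [hint, ← Complex.exp_sum]
    push_cast
    rw [Finset.sum_mul]
  simp_rw [hexp]
  rw [hind.integral_fun_prod_comp (f := fun i r => Complex.exp ((r * (e i : ℝ) : ℝ) * Complex.I))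
    (fun i => (measurable_count (hD i)).ennreal_toReal.aemeasurable)
    (fun i => Measurable.aestronglyMeasurable (by fun_prop)), hintΛ, Complex.exp_sum]
  refine Finset.prod_congr rfl fun i _ => ?_
  have h1 : P.map (fun x => (x.1 (D i)).toReal) =
      (poissonMeasure (Λ (D i)).toNNReal).map (Nat.cast : ℕ → ℝ) := by
    have h2 := congrArg (Measure.map ENNReal.toReal) (h.map_count (D i) (hD i))
    rw [Measure.map_map ENNReal.measurable_toReal (measurable_count (hD i)),
      Measure.map_map ENNReal.measurable_toReal (by fun_prop)] at h2
    simpa [Function.comp_def] using h2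
  have h3 := charFun_map_cast_poissonMeasure (Λ (D i)).toNNReal (e i)
  rw [← h1, charFun_apply_real, integral_map (measurable_count (hD i)).ennreal_toReal.aemeasurable
    (Measurable.aestronglyMeasurable (by fun_prop))] at h3
  refine Eq.trans ?_ (h3.trans ?_)
  · refine integral_congr_ae (Filter.Eventually.of_forall fun x => ?_)
    simp [mul_comm]
  · rfl

/-- The weight of the configurations with `n` points in the law of a Poisson process, relative to
the product measure `Λ^n`. -/
noncomputable def poissonWeight {E : Type*} [MeasurableSpace E] (Λ : Measure E) (n : ℕ) : ℝ :=
  Real.exp (-Λ.real Set.univ) / n.factorial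

theorem poissonWeight_pos {E : Type*} [MeasurableSpace E] (Λ : Measure E) (n : ℕ) :
    0 < poissonWeight Λ n := by
  unfold poissonWeight; positivity

open Config in
/-- The law of a Poisson process as a mixture of the laws of `n` independent points. -/
noncomputable def poissonMixture {E : Type*} [MeasurableSpace E] (Λ : Measure E) :
    Measure (Config E) :=
  Measure.sum fun n : ℕ => ENNReal.ofReal (poissonWeight Λ n) •
    (Measure.pi fun _ : Fin n => Λ).map ofTuple

section

variable {E : Type*} [MeasurableSpace E] (Λ : Measure E) [IsFiniteMeasure Λ]

open Config

instance : IsProbabilityMeasure (poissonMixture Λ) := by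
  refine ⟨?_⟩
  have h := hasSum_one_poissonMeasure (Λ Set.univ).toNNReal
  rw [poissonMixture, Measure.sum_apply _ .univ]
  have h2 := ENNReal.ofReal_tsum_of_nonneg (fun n => by positivity) h.summable
  rw [h.tsum_eq, ENNReal.ofReal_one] at h2
  rw [h2]
  refine tsum_congr fun n => ?_
  rw [Measure.smul_apply, Measure.map_apply (measurable_ofTuple n) .univ, Set.preimage_univ,
    Measure.pi_univ, Finset.prod_const, Finset.card_univ, Fintype.card_fin, smul_eq_mul,
    poissonWeight, ← ofReal_measureReal (μ := Λ) (s := Set.univ), ← ENNReal.ofReal_pow (by positivity),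
    ← ENNReal.ofReal_mul (by positivity)]
  congr 1
  rw [ofReal_measureReal, ENNReal.coe_toNNReal_eq_toReal, ← measureReal_def]
  ring

/-- The `n`-point component contributes `exp(-Λ(E)) z^n / n!` with `z = ∫ exp(i g) dΛ`, and the
exponential series sums to `exp(z - Λ(E))`. -/
theorem poissonMixture_integral_exp (g : SimpleFunc E ℝ) :
    ∫ x, Complex.exp ((∫ b, g b ∂x.1 : ℝ) * Complex.I) ∂(poissonMixture Λ) =
      Complex.exp (∫ b, (Complex.exp (g b * Complex.I) - 1) ∂Λ) := by
  have hmeas : Measurable fun x : Config E =>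
      Complex.exp ((∫ b, g b ∂x.1 : ℝ) * Complex.I) := by
    have : Measurable fun x : Config E => ∫ b, g b ∂x.1 := by
      have : ∀ x : Config E, ∫ b, g b ∂x.1 = ∑ r ∈ g.range, (x.1 (g ⁻¹' {r})).toReal * r := by
        intro x
        rw [← SimpleFunc.integral_eq_integral _ (SimpleFunc.integrable_of_isFiniteMeasure g),
          SimpleFunc.integral_eq]
        rfl
      simp_rw [this]
      exact Finset.measurable_sum _ fun r _ =>
        (measurable_count (g.measurableSet_fiber r)).ennreal_toReal.mul_const r
    fun_prop
  have hi : Integrable (fun x : Config E =>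
      Complex.exp ((∫ b, g b ∂x.1 : ℝ) * Complex.I)) (poissonMixture Λ) := by
    refine Integrable.of_bound hmeas.aestronglyMeasurable 1 (Filter.Eventually.of_forall ?_)
    intro x
    rw [Complex.norm_exp_ofReal_mul_I]
  have hgi : Integrable (fun b => Complex.exp (g b * Complex.I)) Λ := by
    refine Integrable.of_bound ?_ 1 (Filter.Eventually.of_forall fun b => ?_)
    · have := g.measurable
      exact Measurable.aestronglyMeasurable (by fun_prop)
    · rw [Complex.norm_exp_ofReal_mul_I]
  set z := ∫ b, Complex.exp (g b * Complex.I) ∂Λ with hz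
  have hterm : ∀ n : ℕ, ∫ x, Complex.exp ((∫ b, g b ∂x.1 : ℝ) * Complex.I)
      ∂(ENNReal.ofReal (poissonWeight Λ n) •
        (Measure.pi fun _ : Fin n => Λ).map ofTuple) =
      Complex.exp (-Λ.real Set.univ) * (z ^ n / n.factorial) := by
    intro n
    rw [integral_smul_measure, integral_map (measurable_ofTuple n).aemeasurable
      hmeas.aestronglyMeasurable, ENNReal.toReal_ofReal (poissonWeight_pos Λ n).le, poissonWeight]
    have : ∀ v : Fin n → E, Complex.exp ((∫ b, g b ∂(ofTuple v).1 : ℝ) * Complex.I) =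
        ∏ i, Complex.exp (g (v i) * Complex.I) := by
      intro v
      rw [ofTuple_val, integral_finsetSum_measure fun i _ =>
        SimpleFunc.integrable_of_isFiniteMeasure g, ← Complex.exp_sum]
      simp_rw [integral_dirac' _ _ g.stronglyMeasurable]
      push_cast
      rw [Finset.sum_mul]
    simp_rw [this]
    rw [integral_fintype_prod_eq_pow (fun b => Complex.exp (g b * Complex.I)), Fintype.card_fin,
      ← hz, Complex.real_smul]
    push_cast
    ring
  rw [poissonMixture] at hi ⊢
  rw [integral_sum_measure hi]
  simp_rw [hterm]
  rw [tsum_mul_left, integral_sub hgi (integrable_const _), ← hz,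
    ← congrFun NormedSpace.exp_eq_tsum_div z, ← Complex.exp_eq_exp_ℂ, ← Complex.exp_add]
  congr 1
  simp
  ring

variable {Λ} in
theorem IsPoissonLaw.eq_poissonMixture {P : Measure (Config E)} (h : IsPoissonLaw Λ P) :
    P = poissonMixture Λ := by
  have := h.isProbabilityMeasure
  exact ext_of_integral_exp fun g => by
    rw [h.integral_exp, poissonMixture_integral_exp]

end

/-! ### Powers of the intensity measure -/

section TupleMeasure

variable {E : Type*} [MeasurableSpace E] (Λ : Measure E) [IsFiniteMeasure Λ]

theorem measurable_append (k m : ℕ) :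
    Measurable fun z : (Fin k → E) × (Fin m → E) => Fin.append z.1 z.2 := by
  refine measurable_pi_lambda _ fun i => ?_
  refine Fin.addCases (fun i => ?_) (fun i => ?_) i
  · simp only [Fin.append_left]
    fun_prop
  · simp only [Fin.append_right]
    fun_prop

theorem measurePreserving_append (k m : ℕ) :
    MeasurePreserving (fun z : (Fin k → E) × (Fin m → E) => Fin.append z.1 z.2)
      ((Measure.pi fun _ => Λ).prod (Measure.pi fun _ => Λ)) (Measure.pi fun _ => Λ) := by
  refine ⟨measurable_append k m, (Measure.pi_eq fun s hs => ?_).symm⟩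
  rw [Measure.map_apply (measurable_append k m) (.univ_pi hs)]
  have : (fun z : (Fin k → E) × (Fin m → E) => Fin.append z.1 z.2) ⁻¹' Set.univ.pi s =
      (Set.univ.pi fun i => s (Fin.castAdd m i)) ×ˢ (Set.univ.pi fun i => s (Fin.natAdd k i)) := by
    ext z
    simp only [Set.mem_preimage, Set.mem_univ_pi, Set.mem_prod]
    constructor
    · intro h
      exact ⟨fun i => by simpa using h (Fin.castAdd m i), fun i => by simpa using h (Fin.natAdd k i)⟩
    · rintro ⟨h1, h2⟩ i
      refine Fin.addCases (fun i => ?_) (fun i => ?_) i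
      · simpa using h1 i
      · simpa using h2 i
  rw [this, Measure.prod_prod, Measure.pi_pi, Measure.pi_pi, Fin.prod_univ_add]

theorem map_comp_castAdd_pi (k m : ℕ) :
    (Measure.pi fun _ : Fin (k + m) => Λ).map (fun v => v ∘ Fin.castAdd m) =
      (Λ Set.univ ^ m) • Measure.pi fun _ : Fin k => Λ := by
  have hm : Measurable fun v : Fin (k + m) → E => v ∘ Fin.castAdd m :=
    measurable_pi_lambda _ fun i => measurable_pi_apply _
  rw [← (measurePreserving_append Λ k m).map_eq,
    Measure.map_map hm (measurable_append k m)]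
  have : (fun v : Fin (k + m) → E => v ∘ Fin.castAdd m) ∘
      (fun z : (Fin k → E) × (Fin m → E) => Fin.append z.1 z.2) = Prod.fst := by
    ext z i
    simp
  rw [this, Measure.map_fst_prod, Measure.pi_univ]
  simp

/-- Permuting the coordinates preserves a power of a measure. -/
theorem measurePreserving_comp_perm {n : ℕ} (σ : Equiv.Perm (Fin n)) :
    MeasurePreserving (fun v : Fin n → E => v ∘ σ) (Measure.pi fun _ => Λ)
      (Measure.pi fun _ => Λ) := by
  have hm : Measurable fun v : Fin n → E => v ∘ σ :=
    measurable_pi_lambda _ fun i => measurable_pi_apply _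
  refine ⟨hm, (Measure.pi_eq fun s hs => ?_).symm⟩
  rw [Measure.map_apply hm (.univ_pi hs)]
  have : (fun v : Fin n → E => v ∘ σ) ⁻¹' Set.univ.pi s =
      Set.univ.pi fun i => s (σ.symm i) := by
    ext v
    simp only [Set.mem_preimage, Set.mem_univ_pi, Function.comp_apply]
    exact ⟨fun h i => by simpa using h (σ.symm i), fun h i => by simpa using h (σ i)⟩
  rw [this, Measure.pi_pi, σ.symm.prod_comp fun i => Λ (s i)]

theorem measurableEmbedding_comp_perm {n : ℕ} (σ : Equiv.Perm (Fin n)) :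
    MeasurableEmbedding fun v : Fin n → E => v ∘ σ :=
  MeasurableEquiv.measurableEmbedding
    { toEquiv := Equiv.arrowCongr σ.symm (Equiv.refl E)
      measurable_toFun := measurable_pi_lambda _ fun _ => measurable_pi_apply _
      measurable_invFun := measurable_pi_lambda _ fun _ => measurable_pi_apply _ }

/-- With all coordinates but the `i`-th frozen or, as here, with the `i`-th frozen at `a`, the
diagonal `v i = v j` becomes a hyperplane `v j = a`, which is null because `Λ` has no atoms. -/
theorem ae_injective_pi [MeasurableEq E] [NullSingletonClass Λ] (n : ℕ) :
    ∀ᵐ v ∂Measure.pi fun _ : Fin n => Λ, Function.Injective v := by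
  have h : ∀ i j : Fin n, i ≠ j → ∀ᵐ v ∂Measure.pi fun _ : Fin n => Λ, v i ≠ v j := by
    intro i j hij
    obtain _ | n := n
    · exact i.elim0
    obtain ⟨l, rfl⟩ := Fin.exists_succAbove_eq hij.symm
    have hmp := measurePreserving_piFinSuccAbove (fun _ : Fin (n + 1) => Λ) i
    have hS : MeasurableSet {z : E × (Fin n → E) | z.1 = z.2 l} :=
      measurableSet_eq_fun measurable_fst ((measurable_pi_apply l).comp measurable_snd)
    have h0 : ∀ᵐ z ∂Λ.prod (Measure.pi fun _ : Fin n => Λ), z.1 ≠ z.2 l := by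
      rw [ae_iff]
      simp only [ne_eq, not_not]
      rw [Measure.measure_prod_null hS]
      refine Filter.Eventually.of_forall fun a => ?_
      have := Measure.pi_hyperplane (fun _ : Fin n => Λ) l a
      simpa [eq_comm] using this
    have := hmp.quasiMeasurePreserving.ae h0
    simpa [MeasurableEquiv.piFinSuccAbove, Fin.insertNthEquiv, Fin.removeNth] using this
  have h' : ∀ᵐ v ∂Measure.pi fun _ : Fin n => Λ, ∀ i j : Fin n, i ≠ j → v i ≠ v j := by
    simp only [Filter.eventually_all]
    exact h
  filter_upwards [h'] with v hv i j hij
  by_contra hne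
  exact hv i j hne hij

end TupleMeasure

/-! ### Configurations built from tuples -/

namespace Config

variable {E : Type*} [MeasurableSpace E]

theorem addPoints_ofTuple {k m : ℕ} (u : Fin k → E) (w : Fin m → E) :
    (ofTuple w).addPoints u = ofTuple (Fin.append u w) := by
  apply Subtype.ext
  change (ofTuple w).1 + _ = _
  rw [ofTuple_val, ofTuple_val, Fin.sum_univ_add, add_comm]
  simp

theorem ofTuple_comp_perm {n : ℕ} (v : Fin n → E) (σ : Equiv.Perm (Fin n)) :
    ofTuple (v ∘ σ) = ofTuple v := by
  apply Subtype.ext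
  rw [ofTuple_val, ofTuple_val, ← Equiv.sum_comp σ fun i => Measure.dirac (v i)]
  rfl

theorem le_addPoints {n : ℕ} (x : Config E) (u : Fin n → E) : x ≤ x.addPoints u :=
  Measure.le_add_right le_rfl

variable [MeasurableSingletonClass E]

theorem ofTuple_singleton {n : ℕ} {v : Fin n → E} (hv : Function.Injective v) (i : Fin n) :
    (ofTuple v).1 {v i} = 1 := by
  classical
  rw [ofTuple_val, Measure.coe_finsetSum, Finset.sum_apply, Finset.sum_eq_single i]
  · simp
  · intro j _ hj
    rw [Measure.dirac_apply' _ (measurableSet_singleton _)]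
    simp [hv.eq_iff, hj]
  · simp

theorem ofTuple_singleton_of_notMem {n : ℕ} {v : Fin n → E} {b : E} (hb : b ∉ Set.range v) :
    (ofTuple v).1 {b} = 0 := by
  rw [ofTuple_val, Measure.coe_finsetSum, Finset.sum_apply]
  refine Finset.sum_eq_zero fun j _ => ?_
  rw [Measure.dirac_apply' _ (measurableSet_singleton _)]
  simp only [Set.indicator_apply_eq_zero, Set.mem_singleton_iff]
  exact fun h => absurd ⟨j, h⟩ hb

theorem isSimple_ofTuple {n : ℕ} {v : Fin n → E} (hv : Function.Injective v) :
    (ofTuple v).IsSimple := by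
  intro b
  by_cases hb : b ∈ Set.range v
  · obtain ⟨i, rfl⟩ := hb
    exact (ofTuple_singleton hv i).le
  · rw [ofTuple_singleton_of_notMem hb]
    exact zero_le_one

theorem points_ofTuple {n : ℕ} {v : Fin n → E} (hv : Function.Injective v) :
    (ofTuple v).points = Set.range v := by
  ext b
  refine ⟨fun hb => ?_, ?_⟩
  · by_contra hb'
    exact hb (ofTuple_singleton_of_notMem hb')
  · rintro ⟨i, rfl⟩
    change _ ≠ _
    rw [ofTuple_singleton hv i]
    exact one_ne_zero

theorem tuples_ofTuple {n k : ℕ} {v : Fin n → E} (hv : Function.Injective v) :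
    (ofTuple v).tuples k = Set.range fun ι : Fin k ↪ Fin n => v ∘ ι := by
  ext w
  simp only [tuples, points_ofTuple hv, Set.mem_ofPred_eq, Set.mem_range]
  constructor
  · rintro ⟨hw, h⟩
    choose ι hι using h
    refine ⟨⟨ι, fun i j hij => hw ?_⟩, funext hι⟩
    rw [← hι, ← hι, hij]
  · rintro ⟨ι, rfl⟩
    exact ⟨hv.comp ι.injective, fun i => ⟨ι i, rfl⟩⟩

theorem uStatistic_ofTuple {n k : ℕ} (f : (Fin k → E) → ℝ) {v : Fin n → E}
    (hv : Function.Injective v) :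
    uStatistic f (ofTuple v) = ∑ ι : Fin k ↪ Fin n, f (v ∘ ι) := by
  rw [uStatistic, tuples_ofTuple hv, finsum_mem_range, finsum_eq_sum_of_fintype]
  intro ι ι' h
  ext i
  exact congrArg _ (hv (congrFun h i))

end Config

/-- An embedding of an initial segment extends to a permutation. -/
theorem exists_perm_comp_castAdd {k m : ℕ} (ι : Fin k ↪ Fin (k + m)) :
    ∃ σ : Equiv.Perm (Fin (k + m)), σ ∘ Fin.castAdd m = ι := by
  obtain ⟨σ, hσ⟩ := (Equiv.Perm.isMultiplyPretransitive (Fin (k + m)) k).exists_smul_eq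
    (Fin.castAddEmb m) ι
  exact ⟨σ, funext fun i => DFunLike.congr_fun hσ i⟩

open Config

/-- All weights are positive, so almost everywhere measurability under the mixture passes to every
component. -/
theorem map_ofTuple_absolutelyContinuous {E : Type*} [MeasurableSpace E] (Λ : Measure E) (n : ℕ) :
    (Measure.pi fun _ : Fin n => Λ).map ofTuple ≪ poissonMixture Λ :=
  (Measure.absolutelyContinuous_smul (by simpa using poissonWeight_pos Λ n)).trans
    (Measure.le_sum (fun n : ℕ => ENNReal.ofReal (poissonWeight Λ n) •
      (Measure.pi fun _ : Fin n => Λ).map ofTuple) n).absolutelyContinuous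

/-! ### The Mecke measure and heredity -/

section Mixture

variable {E : Type*} [MeasurableSpace E] (Λ : Measure E) [IsFiniteMeasure Λ]

theorem pi_prod_poissonMixture (k : ℕ) :
    (Measure.pi fun _ : Fin k => Λ).prod (poissonMixture Λ) =
      Measure.sum fun m : ℕ => ENNReal.ofReal (poissonWeight Λ m) •
        ((Measure.pi fun _ : Fin k => Λ).prod (Measure.pi fun _ : Fin m => Λ)).map
          (Prod.map id ofTuple) := by
  rw [poissonMixture, Measure.prod_sum_right]
  congr 1
  ext1 m
  rw [Measure.prod_smul_right, ← Measure.map_prod_map _ _ measurable_id (measurable_ofTuple m),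
    Measure.map_id]

/-- The measure which the Mecke formula identifies with the expected sum of the Dirac measures at
`(v, x)`, over the tuples `v` of distinct points of a Poisson process `x`. -/
noncomputable def meckeMeasure (k : ℕ) : Measure ((Fin k → E) × Config E) :=
  ((Measure.pi fun _ : Fin k => Λ).prod (poissonMixture Λ)).map
    fun z => (z.1, z.2.addPoints z.1)

theorem measurable_prodMk_addPoints (k : ℕ) :
    Measurable fun z : (Fin k → E) × Config E => (z.1, z.2.addPoints z.1) :=
  measurable_fst.prodMk (measurable_addPoints k)

theorem measurable_comp_castAdd_prodMk_ofTuple (k m : ℕ) :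
    Measurable fun v : Fin (k + m) → E => (v ∘ Fin.castAdd m, ofTuple v) :=
  (measurable_pi_lambda _ fun _ => measurable_pi_apply _).prodMk (measurable_ofTuple _)

/-- Adding `k` points to `m` points gives a `(k + m)`-tuple whose first `k` entries are marked; the
weight stays that of `m` points. -/
theorem meckeMeasure_eq_sum (k : ℕ) :
    meckeMeasure Λ k = Measure.sum fun m : ℕ => ENNReal.ofReal (poissonWeight Λ m) •
      (Measure.pi fun _ : Fin (k + m) => Λ).map fun v => (v ∘ Fin.castAdd m, ofTuple v) := by
  rw [meckeMeasure, pi_prod_poissonMixture,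
    Measure.map_sum (measurable_prodMk_addPoints k).aemeasurable]
  congr 1
  ext1 m
  rw [Measure.map_smul, Measure.map_map (measurable_prodMk_addPoints k)
    (measurable_id.prodMap (measurable_ofTuple m)), ← (measurePreserving_append Λ k m).map_eq,
    Measure.map_map (measurable_comp_castAdd_prodMk_ofTuple k m) (measurable_append k m)]
  congr 2
  ext1 z
  refine Prod.ext ?_ ?_
  · ext i
    simp
  · simp [addPoints_ofTuple]

theorem quasiMeasurePreserving_fst_meckeMeasure (k : ℕ) :
    Measure.QuasiMeasurePreserving Prod.fst (meckeMeasure Λ k) (Measure.pi fun _ => Λ) := by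
  refine ⟨measurable_fst, ?_⟩
  rw [meckeMeasure, Measure.map_map measurable_fst (measurable_prodMk_addPoints k)]
  change Measure.map Prod.fst _ ≪ _
  rw [Measure.map_fst_prod]
  exact Measure.smul_absolutelyContinuous

theorem map_castAdd_ofTuple_absolutelyContinuous (k m : ℕ) :
    (Measure.pi fun _ : Fin (k + m) => Λ).map (fun v => (v ∘ Fin.castAdd m, ofTuple v)) ≪
      meckeMeasure Λ k := by
  rw [meckeMeasure_eq_sum]
  exact (Measure.absolutelyContinuous_smul (by simpa using poissonWeight_pos Λ m)).trans
    (Measure.le_sum (fun m : ℕ => ENNReal.ofReal (poissonWeight Λ m) •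
      (Measure.pi fun _ : Fin (k + m) => Λ).map
        fun v => (v ∘ Fin.castAdd m, ofTuple v)) m).absolutelyContinuous

/-- Almost surely, adding independent points to a Poisson process creates no multiple points, so
a hereditary density does not vanish before the addition unless it does afterwards. -/
theorem ae_pos_of_addPoints_pos [MeasurableEq E] [MeasurableSingletonClass E]
    [NullSingletonClass Λ] {p : Config E → ℝ≥0} (hp : Measurable p) (hher : IsHereditary p)
    (k : ℕ) :
    ∀ᵐ z ∂(Measure.pi fun _ : Fin k => Λ).prod (poissonMixture Λ),
      0 < p (z.2.addPoints z.1) → 0 < p z.2 := by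
  have hS : MeasurableSet {z : (Fin k → E) × Config E |
      0 < p (z.2.addPoints z.1) → 0 < p z.2} := by
    have h1 : MeasurableSet {z : (Fin k → E) × Config E | 0 < p (z.2.addPoints z.1)} :=
      measurableSet_lt measurable_const (hp.comp (measurable_addPoints k))
    have h2 : MeasurableSet {z : (Fin k → E) × Config E | 0 < p z.2} :=
      measurableSet_lt measurable_const (hp.comp measurable_snd)
    exact h1.imp h2
  rw [pi_prod_poissonMixture, Measure.ae_sum_iff]
  intro m
  refine Measure.ae_smul_measure ?_ _
  rw [ae_map_iff (measurable_id.prodMap (measurable_ofTuple m)).aemeasurable hS]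
  have := (measurePreserving_append Λ k m).quasiMeasurePreserving.ae (ae_injective_pi Λ (k + m))
  filter_upwards [this] with z hz hpos
  refine hher _ _ ?_ (le_addPoints _ z.1) hpos
  simp only [Prod.map_snd, addPoints_ofTuple]
  exact isSimple_ofTuple hz

end Mixture

/-! ### Estimates for the weights -/

theorem ENNReal.mul_le_mul_sq_add_inv_mul_sq {w : ℝ≥0∞} (hw : w ≠ 0) (hw' : w ≠ ∞)
    (a b : ℝ≥0∞) : a * b ≤ w * a ^ 2 + w⁻¹ * b ^ 2 := by
  rcases le_total b (w * a) with h | h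
  · calc a * b ≤ a * (w * a) := by gcongr
      _ = w * a ^ 2 := by ring
      _ ≤ _ := le_self_add
  · calc a * b = w⁻¹ * (w * a) * b := by
          rw [← mul_assoc, ENNReal.inv_mul_cancel hw hw', one_mul]
      _ ≤ w⁻¹ * b * b := by gcongr
      _ = w⁻¹ * b ^ 2 := by ring
      _ ≤ _ := le_add_self

theorem summable_poissonWeight_mul_ascFactorial {E : Type*} [MeasurableSpace E] (Λ : Measure E)
    (k : ℕ) : Summable fun m : ℕ => poissonWeight Λ m *
      (((k + m).factorial : ℝ) / m.factorial) * Λ.real Set.univ ^ m := by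
  -- Since `(k+m)!/m! = k! * choose (k+m) m ≤ k! * 2^(k+m)`, the exponential series at `2 Λ(E)`
  -- dominates.
  have hs := (Real.summable_pow_div_factorial (2 * Λ.real Set.univ)).mul_left
    (Real.exp (-Λ.real Set.univ) * k.factorial * 2 ^ k)
  refine hs.of_nonneg_of_le (fun m => by
    have := (poissonWeight_pos Λ m).le
    positivity) fun m => ?_
  have h1 : ((k + m).factorial : ℝ) / m.factorial ≤ k.factorial * 2 ^ (k + m) := by
    rw [div_le_iff₀ (by positivity)]
    have h2 : (k + m).factorial ≤ k.factorial * 2 ^ (k + m) * m.factorial := by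
      rw [← Nat.add_choose_mul_factorial_mul_factorial k m]
      have := Nat.choose_le_two_pow (k + m) m
      calc (k + m).choose m * k.factorial * m.factorial
          ≤ 2 ^ (k + m) * k.factorial * m.factorial := by gcongr
        _ = _ := by ring
    exact_mod_cast h2
  calc poissonWeight Λ m * (((k + m).factorial : ℝ) / m.factorial) * Λ.real Set.univ ^ m
      ≤ poissonWeight Λ m * (k.factorial * 2 ^ (k + m)) * Λ.real Set.univ ^ m := by
        have := (poissonWeight_pos Λ m).le
        gcongr
    _ = _ := by
        rw [poissonWeight, pow_add, mul_pow]
        ring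

theorem poissonWeight_div {E : Type*} [MeasurableSpace E] (Λ : Measure E) (k m : ℕ) :
    ENNReal.ofReal (poissonWeight Λ m) *
      (ENNReal.ofReal (((k + m).factorial : ℝ) / m.factorial))⁻¹ =
      ENNReal.ofReal (poissonWeight Λ (k + m)) := by
  rw [← ENNReal.ofReal_inv_of_pos (by positivity),
    ← ENNReal.ofReal_mul (poissonWeight_pos Λ m).le, poissonWeight, poissonWeight]
  congr 1
  field_simp

/-! ### Integrability and the Mecke formula -/

section Mecke

variable {E : Type*} [MeasurableSpace E] {Λ : Measure E} [IsFiniteMeasure Λ]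

/-- A product of square integrable functions of the added points and of the resulting process is
integrable. -/
theorem integrable_mul_meckeMeasure {k : ℕ} {f : (Fin k → E) → ℝ} {p : Config E → ℝ≥0}
    (hf : MemLp f 2 (Measure.pi fun _ => Λ)) (hp : Measurable p)
    (hp2 : MemLp (fun x => (p x : ℝ)) 2 (poissonMixture Λ)) :
    Integrable (fun z => f z.1 * (p z.2 : ℝ)) (meckeMeasure Λ k) := by
  have hfm : AEStronglyMeasurable (fun z : (Fin k → E) × Config E => f z.1)
      (meckeMeasure Λ k) :=
    hf.1.comp_quasiMeasurePreserving (quasiMeasurePreserving_fst_meckeMeasure Λ k)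
  have hpm : Measurable fun x => (p x : ℝ) := by fun_prop
  have hmeas : AEStronglyMeasurable (fun z => f z.1 * (p z.2 : ℝ)) (meckeMeasure Λ k) :=
    hfm.mul (hpm.comp measurable_snd).aestronglyMeasurable
  refine ⟨hmeas, ?_⟩
  have hf2 : ∫⁻ u, ‖f u‖ₑ ^ 2 ∂(Measure.pi fun _ : Fin k => Λ) < ∞ := by
    have := (eLpNorm_lt_top_iff_lintegral_rpow_enorm_lt_top (p := 2) (by simp) (by simp)).1 hf.2
    simpa using this
  have hp2' : ∫⁻ x, ‖(p x : ℝ)‖ₑ ^ 2 ∂(poissonMixture Λ) < ∞ := by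
    have := (eLpNorm_lt_top_iff_lintegral_rpow_enorm_lt_top (p := 2) (by simp) (by simp)).1 hp2.2
    simpa using this
  set A := ∫⁻ u, ‖f u‖ₑ ^ 2 ∂(Measure.pi fun _ : Fin k => Λ)
  -- The Young weight is chosen so that dividing the weight of `m` points by `w m` gives the weight
  -- of `k + m` points: the `p²` terms are then components of `E[p²]`, and the `f²` terms still have
  -- summable coefficients.
  let w : ℕ → ℝ := fun m => ((k + m).factorial : ℝ) / m.factorial
  have hw : ∀ m, 0 < w m := fun m => by positivity
  have hterm : ∀ m, ENNReal.ofReal (poissonWeight Λ m) *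
      ∫⁻ z, ‖f z.1 * (p z.2 : ℝ)‖ₑ ∂((Measure.pi fun _ : Fin (k + m) => Λ).map
        fun v => (v ∘ Fin.castAdd m, ofTuple v)) ≤
      ENNReal.ofReal (poissonWeight Λ m * w m * Λ.real Set.univ ^ m) * A +
      ENNReal.ofReal (poissonWeight Λ (k + m)) *
        ∫⁻ x, ‖(p x : ℝ)‖ₑ ^ 2 ∂((Measure.pi fun _ : Fin (k + m) => Λ).map ofTuple) := by
    intro m
    have hcomp : Measurable fun v : Fin (k + m) → E => v ∘ Fin.castAdd m :=
      measurable_pi_lambda _ fun _ => measurable_pi_apply _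
    have h1 : ∫⁻ v, ‖f (v ∘ Fin.castAdd m)‖ₑ ^ 2 ∂(Measure.pi fun _ : Fin (k + m) => Λ) =
        Λ Set.univ ^ m * A := by
      rw [← lintegral_map' (f := fun u => ‖f u‖ₑ ^ 2) ?_ hcomp.aemeasurable, map_comp_castAdd_pi,
        lintegral_smul_measure, smul_eq_mul]
      rw [map_comp_castAdd_pi]
      exact (hf.1.enorm.pow_const 2).smul_measure _
    have hpsq : Measurable fun x => ‖(p x : ℝ)‖ₑ ^ 2 := hpm.enorm.pow_const 2
    rw [lintegral_map' (hmeas.enorm.mono_ac (map_castAdd_ofTuple_absolutelyContinuous Λ k m))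
      (measurable_comp_castAdd_prodMk_ofTuple k m).aemeasurable,
      lintegral_map hpsq (measurable_ofTuple _)]
    calc ENNReal.ofReal (poissonWeight Λ m) * ∫⁻ v : Fin (k + m) → E,
          ‖f (v ∘ Fin.castAdd m) * (p (ofTuple v) : ℝ)‖ₑ ∂(Measure.pi fun _ => Λ)
        ≤ ENNReal.ofReal (poissonWeight Λ m) * ∫⁻ v : Fin (k + m) → E,
          (ENNReal.ofReal (w m) * ‖f (v ∘ Fin.castAdd m)‖ₑ ^ 2 +
            (ENNReal.ofReal (w m))⁻¹ * ‖(p (ofTuple v) : ℝ)‖ₑ ^ 2) ∂(Measure.pi fun _ => Λ) := by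
          gcongr with v
          rw [enorm_mul]
          exact ENNReal.mul_le_mul_sq_add_inv_mul_sq (by simpa using hw m) (by simp) _ _
      _ = _ := by
          have hq : Measurable fun v : Fin (k + m) → E =>
              (ENNReal.ofReal (w m))⁻¹ * ‖(p (ofTuple v) : ℝ)‖ₑ ^ 2 :=
            (hpsq.comp (measurable_ofTuple _)).const_mul _
          rw [lintegral_add_right _ hq,
            lintegral_const_mul' _ _ (by simp),
            lintegral_const_mul' _ _ (by simpa using hw m), h1, mul_add, ← mul_assoc _ _⁻¹,
            poissonWeight_div, ENNReal.ofReal_mul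
              (mul_nonneg (poissonWeight_pos Λ m).le (hw m).le),
            ENNReal.ofReal_mul (poissonWeight_pos Λ m).le,
            ENNReal.ofReal_pow measureReal_nonneg, ofReal_measureReal]
          ring
  have hsum : ∑' m, ENNReal.ofReal (poissonWeight Λ m * w m * Λ.real Set.univ ^ m) < ∞ := by
    rw [← ENNReal.ofReal_tsum_of_nonneg (fun m => by
      have := (poissonWeight_pos Λ m).le
      positivity) (summable_poissonWeight_mul_ascFactorial Λ k)]
    exact ENNReal.ofReal_lt_top
  rw [HasFiniteIntegral, meckeMeasure_eq_sum, lintegral_sum_measure]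
  simp_rw [lintegral_smul_measure, smul_eq_mul]
  refine (ENNReal.tsum_le_tsum hterm).trans_lt ?_
  rw [ENNReal.tsum_add, ENNReal.tsum_mul_right]
  refine ENNReal.add_lt_top.2 ⟨ENNReal.mul_lt_top hsum hf2, lt_of_le_of_lt ?_ hp2'⟩
  rw [poissonMixture, lintegral_sum_measure]
  simp_rw [lintegral_smul_measure, smul_eq_mul]
  -- The `p²` terms form the tail from `k` points on of the series for `E[p²]`.
  exact ENNReal.tsum_comp_le_tsum_of_injective (add_right_injective k) fun n =>
    ENNReal.ofReal (poissonWeight Λ n) *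
      ∫⁻ x, ‖(p x : ℝ)‖ₑ ^ 2 ∂((Measure.pi fun _ : Fin n => Λ).map ofTuple)

variable [MeasurableEq E] [MeasurableSingletonClass E] [NullSingletonClass Λ]

/-- The kernel of a square integrable `U`-statistic is square integrable. -/
theorem memLp_two_of_memLp_uStatistic {k : ℕ} {f : (Fin k → E) → ℝ}
    (hsymm : ∀ (σ : Equiv.Perm (Fin k)) (v : Fin k → E), f (v ∘ σ) = f v)
    (hF : MemLp (uStatistic f) 2 (poissonMixture Λ)) :
    MemLp f 2 (Measure.pi fun _ => Λ) := by
  have hc : ENNReal.ofReal (poissonWeight Λ k) ≠ 0 := by simpa using poissonWeight_pos Λ k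
  have h1 : MemLp (uStatistic f) 2 (ENNReal.ofReal (poissonWeight Λ k) •
      (Measure.pi fun _ : Fin k => Λ).map ofTuple) :=
    hF.mono_measure (Measure.le_sum (fun n : ℕ => ENNReal.ofReal (poissonWeight Λ n) •
      (Measure.pi fun _ : Fin n => Λ).map ofTuple) k)
  have h2 : MemLp (uStatistic f) 2 ((Measure.pi fun _ : Fin k => Λ).map ofTuple) := by
    have := h1.smul_measure (c := (ENNReal.ofReal (poissonWeight Λ k))⁻¹)
      (ENNReal.inv_ne_top.2 hc)
    rwa [smul_smul, ENNReal.inv_mul_cancel hc (by simp), one_smul] at this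
  have h3 : MemLp (uStatistic f ∘ ofTuple) 2 (Measure.pi fun _ : Fin k => Λ) :=
    h2.comp_of_map (measurable_ofTuple k).aemeasurable
  -- On `k` distinct points each embedding is a permutation, so by symmetry `F` is `f` times their
  -- number.
  have h4 := h3.const_mul (Fintype.card (Fin k ↪ Fin k) : ℝ)⁻¹
  refine h4.ae_eq ?_
  filter_upwards [ae_injective_pi Λ k] with v hv
  have hι : ∀ ι : Fin k ↪ Fin k, f (v ∘ ι) = f v := fun ι =>
    hsymm (Equiv.ofBijective ι (Finite.injective_iff_bijective.1 ι.injective)) v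
  have hcard : (Fintype.card (Fin k ↪ Fin k) : ℝ) ≠ 0 := by
    have : Nonempty (Fin k ↪ Fin k) := ⟨Function.Embedding.refl _⟩
    exact_mod_cast Fintype.card_ne_zero
  rw [Function.comp_apply, uStatistic_ofTuple f hv]
  simp_rw [hι]
  rw [Finset.sum_const, Finset.card_univ, nsmul_eq_mul, inv_mul_cancel_left₀ hcard]

/-- The multivariate Mecke formula for the product of a `U`-statistic and a function of the
process. -/
theorem integral_mul_uStatistic {k : ℕ} {f : (Fin k → E) → ℝ} {p : Config E → ℝ≥0}
    (hi : Integrable (fun z => f z.1 * (p z.2 : ℝ)) (meckeMeasure Λ k))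
    (hpF : Integrable (fun x => (p x : ℝ) * uStatistic f x) (poissonMixture Λ)) :
    ∫ x, (p x : ℝ) * uStatistic f x ∂(poissonMixture Λ) =
      ∫ z, f z.1 * (p z.2 : ℝ) ∂(meckeMeasure Λ k) := by
  let I : ℕ → ℝ := fun m => ∫ v, f (v ∘ Fin.castAdd m) * (p (ofTuple v) : ℝ)
    ∂(Measure.pi fun _ : Fin (k + m) => Λ)
  have hIint : ∀ m, Integrable (fun v => f (v ∘ Fin.castAdd m) * (p (ofTuple v) : ℝ))
      (Measure.pi fun _ : Fin (k + m) => Λ) := by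
    intro m
    have hi' := hi
    rw [meckeMeasure_eq_sum] at hi'
    have h1 := hi'.mono_measure (Measure.le_sum _ m)
    rw [integrable_smul_measure (by simpa using poissonWeight_pos Λ m) (by simp)] at h1
    exact (integrable_map_measure h1.1
      (measurable_comp_castAdd_prodMk_ofTuple k m).aemeasurable).1 h1
  have hR : ∫ z, f z.1 * (p z.2 : ℝ) ∂(meckeMeasure Λ k) = ∑' m, poissonWeight Λ m * I m := by
    have hi' := hi
    rw [meckeMeasure_eq_sum] at hi' ⊢
    rw [integral_sum_measure hi']
    refine tsum_congr fun m => ?_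
    rw [integral_smul_measure, ENNReal.toReal_ofReal (poissonWeight_pos Λ m).le, smul_eq_mul,
      integral_map (measurable_comp_castAdd_prodMk_ofTuple k m).aemeasurable
        (hi.1.mono_ac (map_castAdd_ofTuple_absolutelyContinuous Λ k m))]
  let a : ℕ → ℝ := fun n => poissonWeight Λ n *
    ∫ v, ∑ ι : Fin k ↪ Fin n, (p (ofTuple v) : ℝ) * f (v ∘ ι) ∂(Measure.pi fun _ : Fin n => Λ)
  have hL : HasSum a (∫ x, (p x : ℝ) * uStatistic f x ∂(poissonMixture Λ)) := by
    have h := hasSum_integral_measure (μ := fun n : ℕ => ENNReal.ofReal (poissonWeight Λ n) •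
      (Measure.pi fun _ : Fin n => Λ).map ofTuple) hpF
    convert! h using 1
    ext1 n
    symm
    rw [integral_smul_measure, ENNReal.toReal_ofReal (poissonWeight_pos Λ n).le, smul_eq_mul,
      integral_map (measurable_ofTuple n).aemeasurable
        (hpF.1.mono_ac (map_ofTuple_absolutelyContinuous Λ n))]
    congr 1
    refine integral_congr_ae ?_
    filter_upwards [ae_injective_pi Λ n] with v hv
    rw [uStatistic_ofTuple f hv, Finset.mul_sum]
  have ha0 : ∀ n < k, a n = 0 := by
    intro n hn
    have : IsEmpty (Fin k ↪ Fin n) :=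
      Function.Embedding.isEmpty_of_card_lt (by simpa using hn)
    simp [a]
  have hak : ∀ m, a (k + m) = poissonWeight Λ m * I m := by
    intro m
    have h1 : ∀ ι : Fin k ↪ Fin (k + m),
        Integrable (fun v => (p (ofTuple v) : ℝ) * f (v ∘ ι)) (Measure.pi fun _ => Λ) ∧
        ∫ v, (p (ofTuple v) : ℝ) * f (v ∘ ι) ∂(Measure.pi fun _ => Λ) = I m := by
      intro ι
      -- Permuting coordinates preserves both `Λ^(k+m)` and the configuration, so any embedding can
      -- be moved to the initial segment.
      obtain ⟨σ, hσ⟩ := exists_perm_comp_castAdd ι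
      have h2 : (fun v : Fin (k + m) → E => (p (ofTuple v) : ℝ) * f (v ∘ ι)) =
          (fun v => f (v ∘ Fin.castAdd m) * (p (ofTuple v) : ℝ)) ∘ fun v => v ∘ σ := by
        ext v
        simp only [Function.comp_apply, ofTuple_comp_perm]
        rw [Function.comp_assoc, hσ, mul_comm]
      rw [h2]
      exact ⟨((measurePreserving_comp_perm Λ σ).integrable_comp_emb
          (measurableEmbedding_comp_perm σ)).2 (hIint m),
        (measurePreserving_comp_perm Λ σ).integral_comp (measurableEmbedding_comp_perm σ)
          fun v => f (v ∘ Fin.castAdd m) * (p (ofTuple v) : ℝ)⟩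
    simp only [a]
    rw [integral_finsetSum _ fun ι _ => (h1 ι).1, Finset.sum_congr rfl fun ι _ => (h1 ι).2,
      Finset.sum_const, Finset.card_univ, Fintype.card_embedding_eq, Fintype.card_fin,
      Fintype.card_fin, nsmul_eq_mul, ← mul_assoc]
    congr 1
    -- The number of embeddings turns `1/(k+m)!` into `1/m!`.
    have h3 : (m.factorial : ℝ) * (k + m).descFactorial k = (k + m).factorial := by
      have := Nat.factorial_mul_descFactorial (Nat.le_add_right k m)
      rw [Nat.add_sub_cancel_left] at this
      exact_mod_cast this
    rw [poissonWeight, poissonWeight, ← h3]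
    have : ((k + m).descFactorial k : ℝ) ≠ 0 := by
      intro h0
      rw [h0, mul_zero] at h3
      exact (Nat.factorial_ne_zero _) (by exact_mod_cast h3.symm)
    field_simp
  rw [← hL.tsum_eq, hR, ← hL.summable.sum_add_tsum_nat_add k,
    Finset.sum_eq_zero fun n hn => ha0 n (Finset.mem_range.1 hn), zero_add]
  exact tsum_congr fun m => by rw [add_comm, hak]

end Mecke

/-- The expectation of a `U`-statistic of a point process with a hereditary square integrable
density with respect to a Poisson process. -/
theorem integral_uStatistic_withDensity {E : Type*} [MeasurableSpace E] [MeasurableEq E]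
    [MeasurableSingletonClass E] {Λ : Measure E} [IsFiniteMeasure Λ] [NullSingletonClass Λ]
    {p : Config E → ℝ≥0} (hp : Measurable p) (hher : IsHereditary p)
    (hp2 : MemLp (fun x => (p x : ℝ)) 2 (poissonMixture Λ)) {k : ℕ} {f : (Fin k → E) → ℝ}
    (hsymm : ∀ (σ : Equiv.Perm (Fin k)) (v : Fin k → E), f (v ∘ σ) = f v)
    (hF : MemLp (uStatistic f) 2 (poissonMixture Λ)) :
    let M := (poissonMixture Λ).withDensity fun x => (p x : ℝ≥0∞)
    Integrable (uStatistic f) M ∧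
    (∀ᵐ u ∂(Measure.pi fun _ : Fin k => Λ), Integrable (papangelou p k u) M) ∧
    Integrable (fun u => f u * ∫ x, papangelou p k u x ∂M) (Measure.pi fun _ => Λ) ∧
    ∫ x, uStatistic f x ∂M =
      ∫ u, f u * (∫ x, papangelou p k u x ∂M) ∂(Measure.pi fun _ => Λ) := by
  intro M
  have hpm : Measurable fun x => (p x : ℝ) := by fun_prop
  have hpF : Integrable (fun x => (p x : ℝ) * uStatistic f x) (poissonMixture Λ) :=
    hp2.integrable_mul hF
  have hψ := (measurable_prodMk_addPoints (E := E) k).aemeasurable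
    (μ := (Measure.pi fun _ : Fin k => Λ).prod (poissonMixture Λ))
  have hi := integrable_mul_meckeMeasure (memLp_two_of_memLp_uStatistic hsymm hF) hp hp2
  -- The kernel `1` gives integrability of `p(x ∪ u)` itself, hence finiteness of `E[λ*_k(u, μ)]`
  -- for almost every `u`, including where `f u = 0`.
  have hi1 : Integrable (fun z : (Fin k → E) × Config E => (1 : ℝ) * (p z.2 : ℝ))
      (meckeMeasure Λ k) :=
    integrable_mul_meckeMeasure (f := fun _ => 1) (memLp_const 1) hp hp2
  have hmain := integral_mul_uStatistic hi hpF
  have hiprod := (integrable_map_measure hi.1 hψ).1 hi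
  have hi1prod := (integrable_map_measure hi1.1 hψ).1 hi1
  rw [meckeMeasure, integral_map hψ hi.1] at hmain
  have hMi : ∀ g : Config E → ℝ, Integrable g M ↔
      Integrable (fun x => (p x : ℝ) * g x) (poissonMixture Λ) := fun g =>
    integrable_withDensity_iff_integrable_smul hp
  have hMint : ∀ g : Config E → ℝ, ∫ x, g x ∂M =
      ∫ x, (p x : ℝ) * g x ∂(poissonMixture Λ) := fun g =>
    integral_withDensity_eq_integral_smul hp g
  -- Only `p x = 0` is delicate: there the left side vanishes, and heredity makes `p(x ∪ u)` vanish
  -- too. For `k = 0` nothing is added.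
  have hpap : ∀ᵐ u ∂(Measure.pi fun _ : Fin k => Λ), ∀ᵐ x ∂(poissonMixture Λ),
      (p x : ℝ) * papangelou p k u x = p (x.addPoints u) := by
    filter_upwards [Measure.ae_ae_of_ae_prod (ae_pos_of_addPoints_pos Λ hp hher k)] with u hu
    filter_upwards [hu] with x hx
    rw [papangelou]
    split_ifs with hk
    · subst hk
      have : x.addPoints u = x := Subtype.ext (by simp [addPoints])
      rw [this, mul_one]
    · rcases eq_or_ne (p x) 0 with h0 | h0
      · have : p (x.addPoints u) = 0 := by
          by_contra h
          exact (hx (pos_iff_ne_zero.2 h)).ne' h0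
        simp [h0, this]
      · exact mul_div_cancel₀ _ (by exact_mod_cast h0)
  have hval : ∀ᵐ u ∂(Measure.pi fun _ : Fin k => Λ), f u * ∫ x, papangelou p k u x ∂M =
      ∫ x, f u * (p (x.addPoints u) : ℝ) ∂(poissonMixture Λ) := by
    filter_upwards [hpap] with u hu
    rw [hMint, integral_congr_ae hu, integral_const_mul]
  refine ⟨(hMi _).2 hpF, ?_, ?_, ?_⟩
  · filter_upwards [hpap, hi1prod.prod_right_ae] with u hu hu1
    rw [hMi]
    refine hu1.congr ?_
    filter_upwards [hu] with x hx
    simp [hx]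
  · exact hiprod.integral_prod_left.congr (hval.mono fun u hu => hu.symm)
  · rw [hMint, hmain]
    refine (integral_prod _ hiprod).trans ?_
    exact integral_congr_ae (hval.mono fun u hu => hu.symm)

theorem theorem2 {d : ℕ} {B : Set (EuclideanSpace ℝ (Fin d))}
    (hBmeas : MeasurableSet B) (hBbdd : Bornology.IsBounded B) (hBpos : 0 < volume B)
    (Λ : Measure B) [IsFiniteMeasure Λ] [NullSingletonClass Λ]
    (Pη : Measure (Config B)) (hη : IsPoissonLaw Λ Pη)
    (p : Config B → ℝ≥0) (hpmeas : Measurable p) (hpint : ∫⁻ x, (p x : ℝ≥0∞) ∂Pη = 1)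
    (hpher : IsHereditary p) (hpL2 : MemLp (fun x => (p x : ℝ)) 2 Pη)
    {Ω : Type*} [MeasurableSpace Ω] (Pr : Measure Ω) [IsProbabilityMeasure Pr]
    (μ : Ω → Config B) (hμ : HasLaw μ (Pη.withDensity fun x => (p x : ℝ≥0∞)) Pr)
    (k : ℕ) (f : (Fin k → B) → ℝ)
    (hfsymm : ∀ (σ : Equiv.Perm (Fin k)) (v : Fin k → B), f (v ∘ σ) = f v)
    (hfint : Integrable f (Measure.pi fun _ => Λ))
    (hFL2 : MemLp (uStatistic f) 2 Pη) :
    Integrable (fun ω => uStatistic f (μ ω)) Pr ∧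
    (∀ᵐ u ∂(Measure.pi fun _ : Fin k => Λ), Integrable (fun ω => papangelou p k u (μ ω)) Pr) ∧
    Integrable (fun u => f u * ∫ ω, papangelou p k u (μ ω) ∂Pr) (Measure.pi fun _ => Λ) ∧
    ∫ ω, uStatistic f (μ ω) ∂Pr =
      ∫ u, f u * (∫ ω, papangelou p k u (μ ω) ∂Pr) ∂(Measure.pi fun _ => Λ) := by
  rw [hη.eq_poissonMixture] at hpL2 hFL2 hμ
  obtain ⟨h1, h2, h3, h4⟩ := integral_uStatistic_withDensity hpmeas hpher hpL2 hfsymm hFL2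
  have hint : ∀ g : Config B → ℝ, Integrable g (Pr.map μ) → ∫ ω, g (μ ω) ∂Pr =
      ∫ x, g x ∂((poissonMixture Λ).withDensity fun x => (p x : ℝ≥0∞)) := by
    intro g hg
    rw [← hμ.map_eq, integral_map hμ.aemeasurable hg.1]
  -- The inner expectation is transferred to the law of `μ` for those `u` at which the intensity is
  -- integrable, which is almost all of them.
  have hpap : (fun u => f u * ∫ ω, papangelou p k u (μ ω) ∂Pr) =ᵐ[Measure.pi fun _ => Λ]
      fun u => f u * ∫ x, papangelou p k u x
        ∂((poissonMixture Λ).withDensity fun x => (p x : ℝ≥0∞)) := by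
    filter_upwards [h2] with u hu
    rw [hint _ (by rwa [hμ.map_eq])]
  rw [← hμ.map_eq] at h1
  refine ⟨h1.comp_aemeasurable hμ.aemeasurable, ?_, h3.congr hpap.symm, ?_⟩
  · filter_upwards [h2] with u hu
    rw [← hμ.map_eq] at hu
    exact hu.comp_aemeasurable hμ.aemeasurable
  · rw [hint _ h1, h4, integral_congr_ae hpap]
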